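/- Let $n\ge 2$ and let $\mathbb S^n$ be the Euclidean unit sphere in $\mathbb R^{n+1}$. A *spherical convex body* is a closed set $K\subseteq\mathbb S^n$ whose radial extension $\operatorname{rad}K=\{rv : r\ge 0,\ v\in K\}$ is convex in $\mathbb R^{n+1}$; it is *proper* if it contains no pair of antipodal points. A *spherical polytope* is an intersection of finitely many closed hemispheres of $\mathbb S^n$. For $w\in \operatorname{bd}K$ let $L\subseteq w^\perp$ be the image of $K\cap\{v\in\mathbb S^n: w\cdot v>0\}$ under the gnomonic projection $g_w(v)=\frac{v}{w\cdot v}-w$, so that $0=g_w(w)\in \operatorname{bd}L$. The spherical Gauss–Kronecker curvature $H^{\mathbb S^n}_{n-1}(K,w)$ of $K$ at $w$ is the generalized (Aleksandrov) Gauss–Kronecker curvature of $L$ at $0$: if $L$ has an outer unit normal $\nu\in w^\perp$ at $0$ such that, for all $y\in\{w,\nu\}^\perp$ near $0$, the number $f(y)=\min\{t\in\mathbb R : y-t\nu\in L\}$ exists, and $f(y)=\frac12 (Ay)\cdot y+o(\|y\|^2)$ as $y\to0$ for a symmetric linear map $A$ of $\{w,\nu\}^\perp$, then $H^{\mathbb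 S^n}_{n-1}(K,w)=\det A$. This is the case for $\mathcal H^{n-1}$-almost all $w\in\operatorname{bd}K$; on the remaining null set put $H^{\mathbb S^n}_{n-1}(K,w)=0$. The *floating measure* of $K$ is defined for Borel sets $\omega\subseteq\mathbb S^n$ by $$\Omega(K,\omega)=\int_{\omega\cap\operatorname{bd}K}H^{\mathbb S^n}_{n-1}(K,w)^{\frac1{n+1}}\,d\mathcal H^{n-1}(w),$$ where $\operatorname{bd}K$ is the boundary of $K$ in $\mathbb S^n$ and $\mathcal H^{n-1}$ is the $(n-1)$-dimensional Hausdorff measure. **Theorem 7.1.** If $C$ is a spherical polytope or a non-proper spherical convex body in $\mathbb S^n$, then $\Omega(C,\omega)=0$ for every Borel set $\omega\subseteq\mathbb S^n$. -/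

import Mathlib

open scoped MeasureTheory Topology ENNReal RealInnerProductSpace

noncomputable section

namespace SphericalFloating

/-- The unit sphere `𝕊ⁿ` of `ℝⁿ⁺¹`, as a metric space with its Borel sigma-algebra. -/
abbrev Sph (n : ℕ) : Type :=
  Metric.sphere (0 : EuclideanSpace ℝ (Fin (n + 1))) 1

/-- The radial extension `{r v : r ≥ 0, v ∈ A}` of a subset of the sphere. -/
def rad {n : ℕ} (A : Set (Sph n)) : Set (EuclideanSpace ℝ (Fin (n + 1))) :=
  {x | ∃ r : ℝ, 0 ≤ r ∧ ∃ v ∈ A, x = r • (v : EuclideanSpace ℝ (Fin (n + 1)))}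

/-- A spherical convex body is a closed subset of the sphere whose radial extension is convex. -/
def IsConvexBody {n : ℕ} (K : Set (Sph n)) : Prop :=
  IsClosed K ∧ Convex ℝ (rad K)

/-- A set is proper if it contains no pair of antipodal points. -/
def IsProper {n : ℕ} (K : Set (Sph n)) : Prop :=
  ∀ w ∈ K, -w ∉ K

/-- The closed hemisphere `{w : z · w ≤ 0}`, with center `-z`. -/
def negHemisphere {n : ℕ} (z : Sph n) : Set (Sph n) :=
  {w | ⟪(z : EuclideanSpace ℝ (Fin (n + 1))), (w : EuclideanSpace ℝ (Fin (n + 1)))⟫ ≤ 0}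

/-- A spherical polytope is an intersection of finitely many closed hemispheres, in other words
the intersection of the sphere with a polyhedral convex cone. (By the theorem of Minkowski and
Weyl these are also the spherical convex hulls of finite sets.) -/
def IsPolytope {n : ℕ} (P : Set (Sph n)) : Prop :=
  ∃ F : Finset (Sph n), P = ⋂ z ∈ F, negHemisphere z

/-- `HasGaussCurvature L x κ`: the convex set `L` has generalized Gauss-Kronecker curvature `κ`
at its boundary point `x`, in the sense of Aleksandrov.

There is an outer unit normal `ν` of `L` at `x` such that near `x` the boundary of `L` is
the graph over the tangent hyperplane `x + ν⊥` of a function `f`, measured in the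
direction of `-ν` (`f y` is the smallest `t` with `x + y - t ν ∈ L`), with a second order expansion
`f y = ⟪A y, y⟫ / 2 + o(‖y‖²)` for a symmetric operator `A` of `ν⊥`; and `κ = det A`. -/
def HasGaussCurvature {E : Type*} [NormedAddCommGroup E] [InnerProductSpace ℝ E]
    (L : Set E) (x : E) (κ : ℝ) : Prop :=
  ∃ ν : E, ‖ν‖ = 1 ∧ (∀ z ∈ L, ⟪z - x, ν⟫ ≤ 0) ∧
    ∃ (f : (ℝ ∙ ν)ᗮ → ℝ) (A : (ℝ ∙ ν)ᗮ →ₗ[ℝ] (ℝ ∙ ν)ᗮ),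
      A.IsSymmetric ∧
      (∀ᶠ y : (ℝ ∙ ν)ᗮ in 𝓝 0, IsLeast {t : ℝ | x + (y : E) - t • ν ∈ L} (f y)) ∧
      (fun y : (ℝ ∙ ν)ᗮ => f y - ⟪A y, y⟫ / 2) =o[𝓝 0] (fun y : (ℝ ∙ ν)ᗮ => ‖y‖ ^ 2) ∧
      κ = LinearMap.det A

/-- The image of `K ∩ int 𝕊_w⁺` under the gnomonic projection `g_w(v) = v / (w · v) - w`, as
a subset of the linear hyperplane `w⊥` of `ℝⁿ⁺¹`. -/
def gnomonicImage {n : ℕ} (w : Sph n) (K : Set (Sph n)) :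
    Set (ℝ ∙ (w : EuclideanSpace ℝ (Fin (n + 1))))ᗮ :=
  {x | ∃ v ∈ K,
    0 < ⟪(w : EuclideanSpace ℝ (Fin (n + 1))), (v : EuclideanSpace ℝ (Fin (n + 1)))⟫ ∧
    (x : EuclideanSpace ℝ (Fin (n + 1))) =
      (⟪(w : EuclideanSpace ℝ (Fin (n + 1))), (v : EuclideanSpace ℝ (Fin (n + 1)))⟫)⁻¹ •
        (v : EuclideanSpace ℝ (Fin (n + 1))) - (w : EuclideanSpace ℝ (Fin (n + 1)))}

/-- The spherical Gauss-Kronecker curvature of a spherical convex body `K` at `w ∈ bd K`, that is,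
the generalized curvature at `0` of the gnomonic projection of `K` around `w`. It is
non-negative, and it is unique and exists for almost every boundary point with respect to the
`(n-1)`-dimensional Hausdorff measure; on the exceptional null set the value is `0`. -/
def gaussCurvature {n : ℕ} (K : Set (Sph n)) (w : Sph n) : ℝ≥0∞ :=
  ⨆ (κ : ℝ) (_ : HasGaussCurvature (gnomonicImage w K) 0 κ), ENNReal.ofReal κ

/-- The `k`-dimensional Hausdorff measure on `𝕊ⁿ`, normalized (by the volume of a `k`-ball of
diameter one) so that it is the usual `k`-dimensional area. -/
def hausdorff (n k : ℕ) : MeasureTheory.Measure (Sph n) :=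
  MeasureTheory.volume (Metric.ball (0 : EuclideanSpace ℝ (Fin k)) (1 / 2)) •
    MeasureTheory.Measure.hausdorffMeasure (k : ℝ)

/-- The floating measure
`Ω(K, ω) = ∫_{ω ∩ bd K} H_{n-1}(K, w)^(1/(n+1)) dℋⁿ⁻¹(w)`. -/
def floatingMeasure {n : ℕ} (K : Set (Sph n)) (ω : Set (Sph n)) : ℝ≥0∞ :=
  ∫⁻ w in ω ∩ frontier K, gaussCurvature K w ^ (1 / ((n : ℝ) + 1)) ∂(hausdorff n (n - 1))

end SphericalFloating

end

open scoped MeasureTheory Topology ENNReal RealInnerProductSpace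
open Filter

namespace SphericalFloating

/-! ### Generalized curvature in the presence of a segment. -/

section Curvature

variable {E : Type*} [NormedAddCommGroup E] [InnerProductSpace ℝ E]

/-! A segment in the convex set centred at the base point forces `f` to vanish along it. Since `f ≥
0`, the form `A` is positive semidefinite with a null vector, so `det A = 0`
(`HasGaussCurvature.eq_zero_of_segment`). Such segments exist at all but finitely many points of
`C`: if `±v ∈ C`, the cone contains the line through `v`, which can be added to any `w ≠ ±v`; in a
polytope, two non-antipodal distinct points with the same active constraints span a direction that
keeps those constraints tight. As `n - 1 ≥ 1`, finite sets are null. -/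

/-- The coefficient of a second order expansion along a line is controlled by the sign of the
function. -/
theorem nonneg_of_isLittleO_sq {g : ℝ → ℝ} {a : ℝ}
    (hg : ∀ᶠ t in 𝓝 0, 0 ≤ g t)
    (h : (fun t => g t - t ^ 2 * a) =o[𝓝 0] (fun t : ℝ => t ^ 2)) : 0 ≤ a := by
  by_contra! ha
  -- With error at most `-a / 2 * t ^ 2`, one gets `g t ≤ a / 2 * t ^ 2 < 0`.
  have h1 := h.def (c := -a / 2) (by linarith)
  have h2 : ∀ᶠ t in 𝓝[>] (0 : ℝ), 0 ≤ g t ∧ ‖g t - t ^ 2 * a‖ ≤ -a / 2 * ‖t ^ 2‖ :=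
    (hg.and h1).filter_mono nhdsWithin_le_nhds
  obtain ⟨t, ⟨h3, h4⟩, ht⟩ := (h2.and self_mem_nhdsWithin).exists
  have ht0 : 0 < t := ht
  have h5 : 0 < t ^ 2 := by positivity
  rw [Real.norm_eq_abs, Real.norm_eq_abs, abs_of_pos h5] at h4
  have h6 := (abs_le.mp h4).2
  nlinarith

theorem eq_zero_of_isLittleO_sq {a : ℝ}
    (h : (fun t => 0 - t ^ 2 * a) =o[𝓝 0] (fun t : ℝ => t ^ 2)) : a = 0 := by
  refine le_antisymm ?_ (nonneg_of_isLittleO_sq (g := fun _ => 0) (by simp) h)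
  have h' : (fun t => 0 - t ^ 2 * (-a)) =o[𝓝 0] (fun t : ℝ => t ^ 2) := by
    refine h.neg_left.congr_left fun t => ?_
    ring
  linarith [nonneg_of_isLittleO_sq (g := fun _ => 0) (by simp) h']

theorem isLittleO_along_line {f : E → ℝ} {A : E →ₗ[ℝ] E}
    (h : (fun y => f y - ⟪A y, y⟫ / 2) =o[𝓝 0] (fun y : E => ‖y‖ ^ 2)) (v : E) :
    (fun t : ℝ => f (t • v) - t ^ 2 * (⟪A v, v⟫ / 2)) =o[𝓝 0] (fun t : ℝ => t ^ 2) := by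
  have hc : Tendsto (fun t : ℝ => t • v) (𝓝 0) (𝓝 0) := by
    have : Continuous fun t : ℝ => t • v := by fun_prop
    simpa using this.tendsto 0
  have h1 := h.comp_tendsto hc
  refine (h1.congr_left fun t => ?_).trans_isBigO
    (Asymptotics.IsBigO.of_bound (‖v‖ ^ 2) (Eventually.of_forall fun t => ?_))
  · simp only [Function.comp, map_smul, real_inner_smul_left, real_inner_smul_right]
    ring
  · simp only [Function.comp, norm_smul, norm_pow, norm_mul, Real.norm_eq_abs, abs_abs, abs_norm]
    exact le_of_eq (by ring)

/-- A null vector minimizes the form, so the first variation in the direction `A u` must vanish. -/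
theorem map_eq_zero_of_inner_eq_zero {A : E →ₗ[ℝ] E} (hA : A.IsSymmetric)
    (hpos : ∀ v, 0 ≤ ⟪A v, v⟫) {u : E} (hu : ⟪A u, u⟫ = 0) : A u = 0 := by
  have key : ∀ s : ℝ, 0 ≤ 2 * s * ⟪A u, A u⟫ + s ^ 2 * ⟪A (A u), A u⟫ := fun s => by
    have h := hpos (u + s • A u)
    simp only [map_add, map_smul, inner_add_left, inner_add_right, real_inner_smul_left,
      real_inner_smul_right, hu, hA (A u) u] at h
    linarith
  have hc := hpos (A u)
  by_contra hne
  have hp : 0 < ⟪A u, A u⟫ := real_inner_self_pos.mpr hne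
  set p := ⟪A u, A u⟫
  set c := ⟪A (A u), A u⟫
  -- The minimizer would be `-p / c`; the `+ 1` covers `c = 0` and still gives a negative value.
  have h := key (-p / (c + 1))
  have hc1 : 0 < c + 1 := by linarith
  have h2 : 2 * (-p / (c + 1)) * p + (-p / (c + 1)) ^ 2 * c
      = -(p ^ 2 * (c + 2)) / (c + 1) ^ 2 := by
    field_simp
    ring
  rw [h2] at h
  have h3 : 0 < p ^ 2 * (c + 2) / (c + 1) ^ 2 := by positivity
  rw [neg_div] at h
  linarith

/-- If a set contains a segment centred at `x`, its curvature at `x` can only be zero. -/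
theorem HasGaussCurvature.eq_zero_of_segment [FiniteDimensional ℝ E] {L : Set E} {x u : E} {κ : ℝ}
    (h : HasGaussCurvature L x κ) (hu : u ≠ 0) (hL : ∀ᶠ t : ℝ in 𝓝 0, x + t • u ∈ L) :
    κ = 0 := by
  obtain ⟨ν, hν, hsupp, f, A, hA, hf, ho, rfl⟩ := h
  have hνν : ⟪ν, ν⟫ = 1 := by rw [real_inner_self_eq_norm_sq, hν]; norm_num
  have hle : ∀ᶠ t : ℝ in 𝓝 0, t * ⟪u, ν⟫ ≤ 0 := hL.mono fun t ht => by
    simpa [real_inner_smul_left] using hsupp _ ht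
  -- Both `t` and `-t` are admissible, so the support inequality is an equality.
  have horth : ⟪u, ν⟫ = 0 := by
    have hneg : ∀ᶠ t : ℝ in 𝓝 0, -t * ⟪u, ν⟫ ≤ 0 := by
      have : Tendsto (fun t : ℝ => -t) (𝓝 0) (𝓝 0) := by
        simpa using (continuous_neg (G := ℝ)).tendsto 0
      exact this.eventually hle
    obtain ⟨t, ⟨h1, h2⟩, ht⟩ := (((hle.and hneg).filter_mono
      (nhdsWithin_le_nhds (s := Set.Ioi 0))).and self_mem_nhdsWithin).exists
    have ht0 : 0 < t := ht
    have : t * ⟪u, ν⟫ = 0 := by linarith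
    exact (mul_eq_zero.mp this).resolve_left ht0.ne'
  have hnn : ∀ᶠ y : (ℝ ∙ ν)ᗮ in 𝓝 0, 0 ≤ f y := hf.mono fun y hy => by
    have hyν : ⟪(y : E), ν⟫ = 0 := by
      rw [real_inner_comm]
      exact Submodule.mem_orthogonal_singleton_iff_inner_right.mp y.2
    have := hsupp _ hy.1
    rw [show x + (y : E) - f y • ν - x = (y : E) - f y • ν by abel, inner_sub_left,
      real_inner_smul_left, hyν, hνν] at this
    linarith
  have hline : ∀ v : (ℝ ∙ ν)ᗮ, Tendsto (fun t : ℝ => t • v) (𝓝 0) (𝓝 0) := fun v => by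
    have : Continuous fun t : ℝ => t • v := by fun_prop
    simpa using this.tendsto 0
  have hpos : ∀ v, 0 ≤ ⟪A v, v⟫ := fun v => by
    have := nonneg_of_isLittleO_sq ((hline v).eventually hnn) (isLittleO_along_line ho v)
    linarith
  let u' : (ℝ ∙ ν)ᗮ := ⟨u, Submodule.mem_orthogonal_singleton_iff_inner_right.mpr
    (by rw [real_inner_comm]; exact horth)⟩
  have hu' : u' ≠ 0 := fun h0 => hu (congrArg Subtype.val h0)
  have hzero : ∀ᶠ t : ℝ in 𝓝 0, f (t • u') = 0 := by
    filter_upwards [(hline u').eventually hnn, (hline u').eventually hf, hL] with t h1 h2 h3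
    -- The segment makes `0` a competitor for the minimum `f (t • u')`.
    refine le_antisymm (h2.2 ?_) h1
    simpa [u'] using h3
  have hAu : A u' = 0 := by
    refine map_eq_zero_of_inner_eq_zero hA hpos ?_
    have h1 := (isLittleO_along_line ho u').congr' (f₂ := fun t => 0 - t ^ 2 * (⟪A u', u'⟫ / 2))
      (hzero.mono fun t ht => by simp only [ht]) EventuallyEq.rfl
    linarith [eq_zero_of_isLittleO_sq h1]
  by_contra hdet
  exact hu' (LinearMap.ker_eq_bot'.mp ((LinearMap.isUnit_iff_ker_eq_bot A).mp
    ((LinearMap.isUnit_iff_isUnit_det A).mpr (isUnit_iff_ne_zero.mpr hdet))) u' hAu)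

end Curvature

/-! ### Segments in cones over spherical sets. -/

section Sphere

variable {n : ℕ}

theorem inner_coe_self (w : Sph n) :
    ⟪(w : EuclideanSpace ℝ (Fin (n + 1))), (w : EuclideanSpace ℝ (Fin (n + 1)))⟫ = 1 := by
  rw [real_inner_self_eq_norm_sq, norm_eq_of_mem_sphere]
  norm_num

/-- A tangent vector `x` at `w` lies in the gnomonic image as soon as `w + x` lies in the radial
extension. -/
theorem mem_gnomonicImage_of_add_mem_rad {w : Sph n} {K : Set (Sph n)}
    (x : (ℝ ∙ (w : EuclideanSpace ℝ (Fin (n + 1))))ᗮ)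
    (hx : (w : EuclideanSpace ℝ (Fin (n + 1))) + x ∈ rad K) : x ∈ gnomonicImage w K := by
  obtain ⟨r, hr, v, hv, hrv⟩ := hx
  have hwx : ⟪(w : EuclideanSpace ℝ (Fin (n + 1))), (x : EuclideanSpace ℝ (Fin (n + 1)))⟫ = 0 :=
    Submodule.mem_orthogonal_singleton_iff_inner_right.mp x.2
  have h1 : r * ⟪(w : EuclideanSpace ℝ (Fin (n + 1))), (v : EuclideanSpace ℝ (Fin (n + 1)))⟫ = 1 := by
    rw [← real_inner_smul_right, ← hrv, inner_add_right, inner_coe_self, hwx, add_zero]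
  have hpos : 0 < ⟪(w : EuclideanSpace ℝ (Fin (n + 1))), (v : EuclideanSpace ℝ (Fin (n + 1)))⟫ :=
    pos_of_mul_pos_right (one_pos.trans_eq h1.symm) hr
  refine ⟨v, hv, hpos, ?_⟩
  rw [← eq_inv_of_mul_eq_one_left h1, ← hrv, add_sub_cancel_left]

/-- The curvature vanishes where the radial extension contains a segment transversal to the
radial direction. -/
theorem gaussCurvature_eq_zero_of_segment {w : Sph n} {K : Set (Sph n)}
    {u : EuclideanSpace ℝ (Fin (n + 1))} (hu : u ≠ 0)
    (hwu : ⟪(w : EuclideanSpace ℝ (Fin (n + 1))), u⟫ = 0)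
    (h : ∀ᶠ t : ℝ in 𝓝 0, (w : EuclideanSpace ℝ (Fin (n + 1))) + t • u ∈ rad K) :
    gaussCurvature K w = 0 := by
  let u' : (ℝ ∙ (w : EuclideanSpace ℝ (Fin (n + 1))))ᗮ :=
    ⟨u, Submodule.mem_orthogonal_singleton_iff_inner_right.mpr hwu⟩
  have hu' : u' ≠ 0 := fun h0 => hu (congrArg Subtype.val h0)
  simp only [gaussCurvature, ENNReal.iSup_eq_zero]
  intro κ hκ
  rw [hκ.eq_zero_of_segment hu' (h.mono fun t ht => ?_), ENNReal.ofReal_zero]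
  rw [zero_add]
  exact mem_gnomonicImage_of_add_mem_rad _ ht

theorem mem_rad_of_inv_norm_smul_mem {K : Set (Sph n)} {x : EuclideanSpace ℝ (Fin (n + 1))}
    (hx : x ≠ 0) (hK : ∀ v : Sph n, (v : EuclideanSpace ℝ (Fin (n + 1))) = ‖x‖⁻¹ • x → v ∈ K) :
    x ∈ rad K := by
  have hn : ‖x‖ ≠ 0 := norm_ne_zero_iff.mpr hx
  refine ⟨‖x‖, norm_nonneg x, ⟨‖x‖⁻¹ • x, ?_⟩, hK _ rfl, ?_⟩
  · rw [mem_sphere_zero_iff_norm, norm_smul, norm_inv, norm_norm, inv_mul_cancel₀ hn]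
  · rw [smul_smul, mul_inv_cancel₀ hn, one_smul]

theorem add_smul_ne_zero {w : Sph n} {u : EuclideanSpace ℝ (Fin (n + 1))}
    (hwu : ⟪(w : EuclideanSpace ℝ (Fin (n + 1))), u⟫ = 0) (t : ℝ) :
    (w : EuclideanSpace ℝ (Fin (n + 1))) + t • u ≠ 0 := fun h => by
  have := congrArg (fun y => ⟪(w : EuclideanSpace ℝ (Fin (n + 1))), y⟫) h
  simp [inner_add_right, real_inner_smul_right, hwu] at this

theorem smul_mem_rad {K : Set (Sph n)} {x : EuclideanSpace ℝ (Fin (n + 1))} (hx : x ∈ rad K)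
    {s : ℝ} (hs : 0 ≤ s) : s • x ∈ rad K := by
  obtain ⟨r, hr, v, hv, rfl⟩ := hx
  exact ⟨s * r, mul_nonneg hs hr, v, hv, smul_smul _ _ _⟩

theorem add_mem_rad {K : Set (Sph n)} (hK : Convex ℝ (rad K))
    {x y : EuclideanSpace ℝ (Fin (n + 1))} (hx : x ∈ rad K) (hy : y ∈ rad K) :
    x + y ∈ rad K := by
  have h := hK (smul_mem_rad hx zero_le_two) (smul_mem_rad hy zero_le_two)
    (a := 1 / 2) (b := 1 / 2) (by norm_num) (by norm_num) (by norm_num)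
  simpa [smul_smul] using h

/-- The part of `v` tangent to the sphere at `w`. -/
noncomputable def tangentPart (w v : Sph n) : EuclideanSpace ℝ (Fin (n + 1)) :=
  (v : EuclideanSpace ℝ (Fin (n + 1))) -
    ⟪(w : EuclideanSpace ℝ (Fin (n + 1))), (v : EuclideanSpace ℝ (Fin (n + 1)))⟫ •
      (w : EuclideanSpace ℝ (Fin (n + 1)))

theorem inner_tangentPart (w v : Sph n) :
    ⟪(w : EuclideanSpace ℝ (Fin (n + 1))), tangentPart w v⟫ = 0 := by
  simp [tangentPart, inner_sub_right, real_inner_smul_right]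

theorem eq_or_eq_neg_of_tangentPart_eq_zero {w v : Sph n} (h : tangentPart w v = 0) :
    v = w ∨ v = -w := by
  rw [tangentPart, sub_eq_zero] at h
  have h1 := congrArg norm h
  rw [norm_smul, norm_eq_of_mem_sphere, norm_eq_of_mem_sphere, mul_one, Real.norm_eq_abs] at h1
  rcases eq_or_eq_neg_of_abs_eq h1.symm with h2 | h2
  · left; ext1; rw [h, h2, one_smul]
  · right; ext1; rw [h, h2, neg_one_smul]; rfl

/-- For small `t`, `w + t • tangentPart w v` is a positive multiple of `w` plus `t • v`, and `t • v`
lies in the cone for either sign of `t`. -/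
theorem gaussCurvature_eq_zero_of_antipodal {K : Set (Sph n)} (hK : Convex ℝ (rad K))
    {v w : Sph n} (hv : v ∈ K) (hv' : -v ∈ K) (hw : w ∈ K) (h1 : v ≠ w) (h2 : v ≠ -w) :
    gaussCurvature K w = 0 := by
  refine gaussCurvature_eq_zero_of_segment (u := tangentPart w v)
    (fun h => (eq_or_eq_neg_of_tangentPart_eq_zero h).elim h1 h2) (inner_tangentPart w v) ?_
  have hlim : Tendsto (fun t : ℝ => 1 - t * ⟪(w : EuclideanSpace ℝ (Fin (n + 1))),
      (v : EuclideanSpace ℝ (Fin (n + 1)))⟫) (𝓝 0) (𝓝 1) := by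
    have : Continuous fun t : ℝ => 1 - t * ⟪(w : EuclideanSpace ℝ (Fin (n + 1))),
      (v : EuclideanSpace ℝ (Fin (n + 1)))⟫ := by fun_prop
    simpa using this.tendsto 0
  have hrad : ∀ z ∈ K, (z : EuclideanSpace ℝ (Fin (n + 1))) ∈ rad K := fun z hz =>
    ⟨1, zero_le_one, z, hz, (one_smul _ _).symm⟩
  filter_upwards [hlim.eventually (lt_mem_nhds one_pos)] with t ht
  have hline : t • (v : EuclideanSpace ℝ (Fin (n + 1))) ∈ rad K := by
    rcases le_total 0 t with h | h
    · exact smul_mem_rad (hrad v hv) h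
    · have := smul_mem_rad (hrad _ hv') (neg_nonneg.mpr h)
      simpa using this
  have := add_mem_rad hK (smul_mem_rad (hrad w hw) ht.le) hline
  convert this using 1
  rw [tangentPart]
  module

/-- At all but finitely many points of a polytope, there is a tangent direction orthogonal to
the normals of all active constraints. -/
theorem gaussCurvature_eq_zero_of_active {F : Finset (Sph n)} {w v : Sph n}
    (hw : w ∈ ⋂ z ∈ F, negHemisphere z) (h1 : v ≠ w) (h2 : v ≠ -w)
    (hact : ∀ z ∈ F,
      ⟪(z : EuclideanSpace ℝ (Fin (n + 1))), (w : EuclideanSpace ℝ (Fin (n + 1)))⟫ = 0 →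
      ⟪(z : EuclideanSpace ℝ (Fin (n + 1))), (v : EuclideanSpace ℝ (Fin (n + 1)))⟫ = 0) :
    gaussCurvature (⋂ z ∈ F, negHemisphere z) w = 0 := by
  refine gaussCurvature_eq_zero_of_segment (u := tangentPart w v)
    (fun h => (eq_or_eq_neg_of_tangentPart_eq_zero h).elim h1 h2) (inner_tangentPart w v) ?_
  have hev : ∀ᶠ t : ℝ in 𝓝 0, ∀ z ∈ F, ⟪(z : EuclideanSpace ℝ (Fin (n + 1))),
      (w : EuclideanSpace ℝ (Fin (n + 1))) + t • tangentPart w v⟫ ≤ 0 := by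
    rw [Filter.eventually_all_finset]
    intro z hz
    have hwz : ⟪(z : EuclideanSpace ℝ (Fin (n + 1))),
        (w : EuclideanSpace ℝ (Fin (n + 1)))⟫ ≤ 0 := Set.mem_iInter₂.mp hw z hz
    -- Active constraints stay tight along the whole line; inactive ones persist by continuity.
    rcases hwz.eq_or_lt with h | h
    · refine Eventually.of_forall fun t => le_of_eq ?_
      simp [tangentPart, inner_add_right, inner_sub_right, real_inner_smul_right, h, hact z hz h]
    · have hc : Continuous fun t : ℝ => ⟪(z : EuclideanSpace ℝ (Fin (n + 1))),
          (w : EuclideanSpace ℝ (Fin (n + 1))) + t • tangentPart w v⟫ := by fun_prop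
      refine ((hc.tendsto 0).eventually (gt_mem_nhds (by simpa using h))).mono fun t ht => ht.le
  filter_upwards [hev] with t ht
  refine mem_rad_of_inv_norm_smul_mem (add_smul_ne_zero (inner_tangentPart w v) t)
    fun y hy => Set.mem_iInter₂.mpr fun z hz => ?_
  change ⟪(z : EuclideanSpace ℝ (Fin (n + 1))), (y : EuclideanSpace ℝ (Fin (n + 1)))⟫ ≤ 0
  rw [hy, real_inner_smul_right]
  exact mul_nonpos_of_nonneg_of_nonpos (inv_nonneg.mpr (norm_nonneg _)) (ht z hz)

/-- There are finitely many active sets, and each is shared by at most one antipodal pair of curved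
points. -/
theorem finite_curved_points_of_polytope (F : Finset (Sph n)) :
    {w ∈ ⋂ z ∈ F, negHemisphere z |
      gaussCurvature (⋂ z ∈ F, negHemisphere z) w ≠ 0}.Finite := by
  classical
  let active : Sph n → Finset (Sph n) := fun w => F.filter fun z =>
    ⟪(z : EuclideanSpace ℝ (Fin (n + 1))), (w : EuclideanSpace ℝ (Fin (n + 1)))⟫ = 0
  refine Set.Finite.of_finite_fibers active
    ((F.powerset.finite_toSet).subset ?_) ?_
  · rintro _ ⟨w, -, rfl⟩
    exact Finset.mem_coe.mpr (Finset.mem_powerset.mpr (Finset.filter_subset _ F))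
  · rintro _ ⟨w, ⟨hw, hcurv⟩, rfl⟩
    refine (Set.toFinite {w, -w}).subset ?_
    rintro v ⟨-, hv⟩
    by_contra hne
    simp only [Set.mem_insert_iff, Set.mem_singleton_iff, not_or] at hne
    refine hcurv (gaussCurvature_eq_zero_of_active hw hne.1 hne.2 fun z hz h => ?_)
    have hz' : z ∈ active v := by
      rw [show active v = active w from hv]
      exact Finset.mem_filter.mpr ⟨hz, h⟩
    exact (Finset.mem_filter.mp hz').2

/-! ### Finite sets are negligible for the floating measure. -/

theorem hausdorff_finite_eq_zero {k : ℕ} (hk : k ≠ 0) {S : Set (Sph n)} (hS : S.Finite) :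
    hausdorff n k S = 0 := by
  have : MeasureTheory.NullSingletonClass (MeasureTheory.Measure.hausdorffMeasure (X := Sph n) (k : ℝ)) :=
    MeasureTheory.Measure.nullSingletonClass_hausdorff _ (by positivity)
  rw [hausdorff, MeasureTheory.Measure.smul_apply, hS.measure_zero, smul_zero]

theorem floatingMeasure_eq_zero_of_finite (hn : 2 ≤ n) {K : Set (Sph n)}
    (hK : IsClosed K) (h : {w ∈ K | gaussCurvature K w ≠ 0}.Finite) {ω : Set (Sph n)}
    (hω : MeasurableSet ω) : floatingMeasure K ω = 0 := by
  rw [floatingMeasure, MeasureTheory.setLIntegral_congr_fun_ae (g := fun _ => 0)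
    (hω.inter isClosed_frontier.measurableSet), MeasureTheory.lintegral_zero]
  have hnull := hausdorff_finite_eq_zero (k := n - 1) (by omega) h
  filter_upwards [MeasureTheory.measure_eq_zero_iff_ae_notMem.mp hnull] with w hw hwf
  have hcurv : gaussCurvature K w = 0 := by
    by_contra hne
    exact hw ⟨hK.frontier_subset hwf.2, hne⟩
  rw [hcurv, ENNReal.zero_rpow_of_pos (by positivity)]

theorem isClosed_negHemisphere (z : Sph n) : IsClosed (negHemisphere z) :=
  isClosed_le (by fun_prop) continuous_const

end Sphere

end SphericalFloating

theorem theorem7p1 (n : ℕ) (hn : 2 ≤ n) (C : Set (SphericalFloating.Sph n))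
    (hC : SphericalFloating.IsPolytope C ∨
      (SphericalFloating.IsConvexBody C ∧ ¬ SphericalFloating.IsProper C)) :
    ∀ ω : Set (SphericalFloating.Sph n), MeasurableSet ω →
      SphericalFloating.floatingMeasure C ω = 0 := by
  intro ω hω
  rcases hC with ⟨F, rfl⟩ | ⟨⟨hclosed, hconv⟩, hprop⟩
  · exact SphericalFloating.floatingMeasure_eq_zero_of_finite hn
      (isClosed_biInter fun z _ => SphericalFloating.isClosed_negHemisphere z)
      (SphericalFloating.finite_curved_points_of_polytope F) hω
  · rw [SphericalFloating.IsProper] at hprop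
    push Not at hprop
    obtain ⟨v, hv, hv'⟩ := hprop
    refine SphericalFloating.floatingMeasure_eq_zero_of_finite hn hclosed
      ((Set.toFinite {v, -v}).subset ?_) hω
    rintro w ⟨hw, hcurv⟩
    by_contra hne
    simp only [Set.mem_insert_iff, Set.mem_singleton_iff, not_or] at hne
    exact hcurv (SphericalFloating.gaussCurvature_eq_zero_of_antipodal hconv hv hv' hw
      (fun h => hne.1 h.symm) (fun h => hne.2 (by rw [h, neg_neg])))
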